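/- Let $(\Omega,\mathcal F,\mathbb P)$ be a probability space and let $p:\Omega\to(0,\infty)$ be measurable. For $A\subseteq\Omega$ put $p_-(A)=\inf_{x\in A}p(x)$, $p_+(A)=\sup_{x\in A}p(x)$, $p_\pm=p_\pm(\Omega)$. Suppose $1\le p_-\le p_+<\infty$, and that there is a constant $K\ge 1$ with $$\mathbb P(A)^{p_-(A)-p_+(A)}\le K\qquad\text{for all }A\in\mathcal F\text{ with }\mathbb P(A)>0. \tag{1}$$ For measurable $g$ let $\|g\|_{p(\cdot)}=\inf\{\lambda>0:\int_\Omega(|g(x)|/\lambda)^{p(x)}\,d\mathbb P\le 1\}$. For a filtration $(\mathcal F_n)_{n\ge0}$ on $(\Omega,\mathcal F)$ let $\mathcal T$ be the set of its stopping times $\tau:\Omega\to\{0,1,2,\dots\}\cup\{\infty\}$. For a real martingale $f=(f_n)_{n\ge0}$ put $f_{-1}=f_0$ and $f^{\tau-1}_n=f_{n\wedge(\tau-1)}$, and let $f\in BMO_1$ mean that $$\|f\|_{BMO_1}=\sup_{\tau\in\mathcal T}\ \|\chi_{\{\tau<\infty\}}\|_1^{-1}\ \sup_{n\ge0}\|f_n-f^{\tau-1}_n\|_1<\infty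 ,$$ where the stopping times with $\mathbb P(\tau<\infty)=0$ contribute $0$. **Theorem.** There are constants $C_1,C_2>0$, depending only on $(\Omega,\mathcal F,\mathbb P)$ and $p(\cdot)$, such that for every filtration $(\mathcal F_n)_{n\ge 0}$ and every martingale $f\in BMO_1$ with respect to it, $f_n$ converges almost surely to a finite limit, again denoted by $f$, and for all $\tau\in\mathcal T$ and all $t>0$ $$\big\|\chi_{\{\tau<\infty\}\cap\{f-f_{\tau-1}\ge t\}}\big\|_{p(\cdot)}\le C_1\,e^{-C_2t/\|f\|_{BMO_1}}\ \|\chi_{\{\tau<\infty\}}\|_{p(\cdot)},$$ where for $\|f\|_{BMO_1}=0$ the right-hand side is read as $0$. -/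

import Mathlib

open MeasureTheory ProbabilityTheory Filter Topology
open scoped ENNReal

noncomputable section

namespace VarExpMartingale

variable {Ω : Type*} {mΩ : MeasurableSpace Ω}

/-- `p_-(A) = inf_{x ∈ A} p(x)`. -/
def expInf (p : Ω → ℝ) (A : Set Ω) : ℝ := sInf (p '' A)

/-- `p_+(A) = sup_{x ∈ A} p(x)`. -/
def expSup (p : Ω → ℝ) (A : Set Ω) : ℝ := sSup (p '' A)

/-- There is `K ≥ 1` with `P(A) ^ (p_-(A) - p_+(A)) ≤ K` for all measurable `A` with `P(A) > 0`. -/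
def ExponentCondition (P : Measure Ω) (p : Ω → ℝ) : Prop :=
  ∃ K : ℝ, 1 ≤ K ∧ ∀ A : Set Ω, MeasurableSet A → P A ≠ 0 →
    (P A).toReal ^ (expInf p A - expSup p A) ≤ K

/-- The modular `ρ(g) = ∫ |g(x)| ^ p(x) dP`. -/
def modular (P : Measure Ω) (p : Ω → ℝ) (g : Ω → ℝ) : ℝ≥0∞ :=
  ∫⁻ x, ENNReal.ofReal (|g x| ^ p x) ∂P

/-- The Luxemburg quasi-norm `‖g‖_{p(·)} = inf {r > 0 : ρ(g / r) ≤ 1}`, with `inf ∅ = ∞`. -/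
def varNorm (P : Measure Ω) (p : Ω → ℝ) (g : Ω → ℝ) : ℝ≥0∞ :=
  ⨅ (r : ℝ) (_ : 0 < r ∧ modular P p (fun x => g x / r) ≤ 1), ENNReal.ofReal r

/-- The characteristic function of a set. -/
def chi (A : Set Ω) : Ω → ℝ := A.indicator 1

/-- The time `τ - 1`. Since `0 - 1 = 0` here, evaluating a process at `τ - 1` uses the convention
`f_{-1} = f_0`; where `τ = ∞`, also `τ - 1 = ∞`. -/
def predTime (τ : Ω → WithTop ℕ) : Ω → WithTop ℕ := fun ω => τ ω - 1

/-- `‖f‖_{BMO_q} = sup_τ ‖χ_{τ<∞}‖_q⁻¹ ‖f - f^{τ-1}‖_q` over all stopping times `τ`, where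
`f^{τ-1}_n = f_{n ∧ (τ-1)}` and the `L^q` norm of a sequence is the supremum of the norms of its
terms. Where `P(τ < ∞) = 0` both norms vanish, and the term is `∞ * 0 = 0`. -/
def bmoNorm (q : ℝ≥0∞) (P : Measure Ω) (ℱ : Filtration ℕ mΩ) (f : ℕ → Ω → ℝ) : ℝ≥0∞ :=
  ⨆ (τ : Ω → WithTop ℕ) (_ : IsStoppingTime ℱ τ),
    (eLpNorm (chi {ω | τ ω < ⊤}) q P)⁻¹ *
      ⨆ n : ℕ, eLpNorm (fun ω => f n ω - stoppedProcess f (predTime τ) n ω) q P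

/-- `f ∈ BMO_q`: a martingale with finite `BMO_q` norm. -/
def MemBMO (q : ℝ≥0∞) (P : Measure Ω) (ℱ : Filtration ℕ mΩ) (f : ℕ → Ω → ℝ) : Prop :=
  Martingale f ℱ P ∧ bmoNorm q P ℱ f < ⊤

/-- The set `{τ < ∞} ∩ {f - f_{τ-1} ≥ t}`, where `f` stands for the almost sure limit `f_∞` of the
martingale `(f_n)`. -/
def levelSet (P : Measure Ω) (ℱ : Filtration ℕ mΩ) (f : ℕ → Ω → ℝ) (τ : Ω → WithTop ℕ) (t : ℝ) :
    Set Ω :=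
  {ω | τ ω < ⊤} ∩ {ω | t ≤ Filtration.limitProcess f ℱ P ω - stoppedValue f (predTime τ) ω}

end VarExpMartingale

end

namespace VarExpMartingale

variable {Ω : Type*} {mΩ : MeasurableSpace Ω}

/-! ### John–Nirenberg decay in measure for `BMO_1` martingales. -/

section Martingale

variable {P : Measure Ω} {ℱ : Filtration ℕ mΩ} {f : ℕ → Ω → ℝ} {τ : Ω → WithTop ℕ}

/-! Let B be the BMO norm, assumed nonzero, and let σ be the first time from τ on at which |f -
f_{τ-1}| > 2B. Chebyshev and the L¹ growth of martingale increments give P(σ < ∞) ≤ P(τ < ∞)/2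
(`measure_exitTime_lt_top_le`). The next exit is measured from f_{σ-1}, which is still within 2B of
f_{τ-1}, so jumps cost nothing: if the m-th iterated exit never happens, the limit is within 2Bm of
f_{τ-1} (`eventually_abs_sub_le`). Hence the level set has measure at most 2^{-m} P(τ < ∞) whenever
2Bm < t (`measure_levelSet_le`).

For T = {τ < ∞} and A ⊆ T, ‖χ_A‖ ≤ δ^{1/p_+(T)} when P(A) ≤ δ ≤ 1, while ‖χ_T‖ ≥ P(T)^{1/p_-(T)}.
The exponent condition on T reconciles the two powers of P(T), so geometric decay in measure becomes
geometric decay in norm (`varNorm_chi_le_mul`). -/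

lemma predTime_of_eq_coe {ω : Ω} {j : ℕ} (h : τ ω = WithTop.some j) :
    predTime τ ω = WithTop.some (j - 1) := by
  rw [predTime, h]; rfl

lemma stoppedValue_predTime {ω : Ω} {j : ℕ} (h : τ ω = WithTop.some j) :
    stoppedValue f (predTime τ) ω = f (j - 1) ω := by
  rw [stoppedValue, predTime_of_eq_coe h]; rfl

lemma stoppedProcess_predTime {ω : Ω} {j n : ℕ} (h : τ ω = WithTop.some j) (hn : j ≤ n) :
    stoppedProcess f (predTime τ) n ω = f (j - 1) ω := by
  have h1 : min (WithTop.some n) (WithTop.some (j - 1)) = WithTop.some (j - 1) :=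
    min_eq_right (WithTop.coe_le_coe.2 ((j.sub_le 1).trans hn))
  rw [stoppedProcess, predTime_of_eq_coe h, h1]; rfl

lemma measurableSet_lt_top (hτ : IsStoppingTime ℱ τ) : MeasurableSet {ω | τ ω < ⊤} := by
  have : {ω | τ ω < ⊤} = ⋃ n : ℕ, {ω | τ ω = WithTop.some n} := by
    ext ω; simp [lt_top_iff_ne_top, WithTop.ne_top_iff_exists, eq_comm]
  rw [this]
  exact .iUnion fun n => ℱ.le n _ (hτ.measurableSet_eq n)

lemma eLpNorm_one_chi {A : Set Ω} (hA : MeasurableSet A) : eLpNorm (chi A) 1 P = P A := by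
  have : chi A = A.indicator fun _ => (1 : ℝ) := rfl
  rw [this, eLpNorm_indicator_const hA one_ne_zero ENNReal.one_ne_top]
  simp

lemma eLpNorm_sub_stoppedProcess_le [IsFiniteMeasure P] (hf : bmoNorm 1 P ℱ f < ⊤)
    (hτ : IsStoppingTime ℱ τ) (n : ℕ) :
    eLpNorm (fun ω => f n ω - stoppedProcess f (predTime τ) n ω) 1 P ≤
      bmoNorm 1 P ℱ f * P {ω | τ ω < ⊤} := by
  have h : (eLpNorm (chi {ω | τ ω < ⊤}) 1 P)⁻¹ *
      ⨆ n : ℕ, eLpNorm (fun ω => f n ω - stoppedProcess f (predTime τ) n ω) 1 P ≤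
        bmoNorm 1 P ℱ f := by
    unfold bmoNorm
    exact le_iSup₂ (f := fun (τ : Ω → WithTop ℕ) (_ : IsStoppingTime ℱ τ) =>
      (eLpNorm (chi {ω | τ ω < ⊤}) 1 P)⁻¹ *
        ⨆ n : ℕ, eLpNorm (fun ω => f n ω - stoppedProcess f (predTime τ) n ω) 1 P) τ hτ
  rw [eLpNorm_one_chi (measurableSet_lt_top hτ)] at h
  refine (le_iSup (fun n => eLpNorm (fun ω => f n ω - stoppedProcess f (predTime τ) n ω) 1 P)
    n).trans ?_
  rcases eq_or_ne (P {ω | τ ω < ⊤}) 0 with h0 | h0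
  -- The inverse is `∞` here, so a finite product forces the supremum to vanish.
  · rw [h0, ENNReal.inv_zero] at h
    have h1 := h.trans_lt hf
    rw [ENNReal.mul_lt_top_iff] at h1
    rcases h1 with h1 | h1 | h1
    · exact absurd h1.1 (lt_irrefl _)
    · exact absurd h1 ENNReal.top_ne_zero
    · rw [h1]; exact zero_le
  · rwa [ENNReal.inv_mul_le_iff h0 (measure_ne_top _ _), mul_comm] at h

open Classical in
/-- The first time `n ≥ τ` at which `|f n - f (τ - 1)|` exceeds `c`. -/
noncomputable def exitTime (f : ℕ → Ω → ℝ) (c : ℝ) (τ : Ω → WithTop ℕ) (ω : Ω) : WithTop ℕ :=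
  if h : ∃ n : ℕ, τ ω ≤ WithTop.some n ∧ c < |f n ω - stoppedValue f (predTime τ) ω|
    then WithTop.some (Nat.find h) else ⊤

lemma exitTime_spec {c : ℝ} {ω : Ω} {k : ℕ} (h : exitTime f c τ ω = WithTop.some k) :
    (τ ω ≤ WithTop.some k ∧ c < |f k ω - stoppedValue f (predTime τ) ω|) ∧
      ∀ n < k, τ ω ≤ WithTop.some n → |f n ω - stoppedValue f (predTime τ) ω| ≤ c := by
  classical
  unfold exitTime at h
  split_ifs at h with hex
  · rw [WithTop.coe_inj] at h
    subst h
    refine ⟨Nat.find_spec hex, fun n hn hτn => ?_⟩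
    have := Nat.find_min hex hn
    push Not at this
    exact this hτn
  · exact absurd h WithTop.top_ne_coe

lemma exitTime_le_iff {c : ℝ} {ω : Ω} {k : ℕ} :
    exitTime f c τ ω ≤ WithTop.some k ↔
      ∃ n ≤ k, τ ω ≤ WithTop.some n ∧ c < |f n ω - stoppedValue f (predTime τ) ω| := by
  classical
  unfold exitTime
  split_ifs with hex
  · rw [WithTop.coe_le_coe, Nat.find_le_iff]
  · refine ⟨fun h => absurd h (WithTop.coe_lt_top k).not_ge, fun ⟨n, _, hn⟩ => (hex ⟨n, hn⟩).elim⟩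

lemma abs_sub_le_of_exitTime_eq_top {c : ℝ} {ω : Ω} (h : exitTime f c τ ω = ⊤) {n : ℕ}
    (hn : τ ω ≤ WithTop.some n) : |f n ω - stoppedValue f (predTime τ) ω| ≤ c := by
  by_contra! hc
  have := exitTime_le_iff.2 ⟨n, le_rfl, hn, hc⟩
  simp [h] at this

lemma isStoppingTime_exitTime (hf : StronglyAdapted ℱ f) (hτ : IsStoppingTime ℱ τ) (c : ℝ) :
    IsStoppingTime ℱ (exitTime f c τ) := by
  intro k
  have : {ω | exitTime f c τ ω ≤ WithTop.some k} =
      ⋃ n ∈ Finset.range (k + 1), ⋃ j ∈ Finset.range (n + 1),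
        {ω | τ ω = WithTop.some j} ∩ {ω | c < |f n ω - f (j - 1) ω|} := by
    ext ω
    simp only [Set.mem_ofPred_eq, exitTime_le_iff, Set.mem_iUnion, Finset.mem_range, Nat.lt_succ_iff,
      Set.mem_inter_iff, exists_prop]
    refine exists_congr fun n => and_congr_right fun _ => ⟨fun ⟨h, hc⟩ => ?_, ?_⟩
    · obtain ⟨j, hj⟩ := WithTop.ne_top_iff_exists.1 (h.trans_lt (WithTop.coe_lt_top n)).ne
      rw [← hj, WithTop.coe_le_coe] at h
      exact ⟨j, h, hj.symm, by rwa [stoppedValue_predTime hj.symm] at hc⟩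
    · rintro ⟨j, hj, hτj, hc⟩
      rw [hτj, stoppedValue_predTime hτj]
      exact ⟨by exact_mod_cast hj, hc⟩
  rw [this]
  refine Finset.measurableSet_biUnion _ fun n hn => Finset.measurableSet_biUnion _ fun j hj => ?_
  have hn' : n ≤ k := Nat.lt_succ_iff.1 (Finset.mem_range.1 hn)
  have hj' : j ≤ n := Nat.lt_succ_iff.1 (Finset.mem_range.1 hj)
  refine (ℱ.mono (hj'.trans hn') _ (hτ.measurableSet_eq j)).inter ?_
  have h1 : Measurable[ℱ k] (f n) := ((hf n).mono (ℱ.mono hn')).measurable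
  have h2 : Measurable[ℱ k] (f (j - 1)) :=
    ((hf (j - 1)).mono (ℱ.mono ((j.sub_le 1).trans (hj'.trans hn')))).measurable
  exact measurableSet_lt measurable_const (continuous_abs.measurable.comp (h1.sub h2))

/-- On events of the past, the increments of a martingale grow in `L¹`. -/
lemma setLIntegral_enorm_sub_le [IsFiniteMeasure P] (hf : Martingale f ℱ P) {i k n : ℕ}
    (hik : i ≤ k) (hkn : k ≤ n) {E : Set Ω} (hE : MeasurableSet[ℱ k] E) :
    ∫⁻ ω in E, ‖f k ω - f i ω‖ₑ ∂P ≤ ∫⁻ ω in E, ‖f n ω - f i ω‖ₑ ∂P := by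
  have hE' : MeasurableSet E := ℱ.le k _ hE
  have h1 : P[f n - f i | ℱ k] =ᵐ[P] f k - f i := by
    have h2 := condExp_sub (hf.integrable n) (hf.integrable i) (ℱ k)
    have h3 : P[f i | ℱ k] = f i := condExp_of_stronglyMeasurable (ℱ.le k)
      ((hf.stronglyMeasurable i).mono (ℱ.mono hik)) (hf.integrable i)
    rw [h3] at h2
    filter_upwards [h2, hf.condExp_ae_eq hkn] with ω a b
    rw [a, Pi.sub_apply, Pi.sub_apply, b]
  have h4 : P[E.indicator (f n - f i) | ℱ k] =ᵐ[P] E.indicator (f k - f i) := by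
    filter_upwards [condExp_indicator ((hf.integrable n).sub (hf.integrable i)) hE, h1] with ω a b
    rw [a]
    by_cases hω : ω ∈ E <;> simp [hω, b]
  have h5 := eLpNorm_condExp_le_eLpNorm (μ := P) (m := ℱ k) (E.indicator (f n - f i)) le_rfl
  rw [eLpNorm_congr_ae h4, eLpNorm_indicator_eq_eLpNorm_restrict hE',
    eLpNorm_indicator_eq_eLpNorm_restrict hE', eLpNorm_one_eq_lintegral_enorm,
    eLpNorm_one_eq_lintegral_enorm] at h5
  exact h5

/-- Chebyshev at the exit time k on each piece {τ = j, exit = k}, which lies in `ℱ k`; the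
martingale property then moves the increment from time k to time n, and the disjoint pieces are
summed. -/
lemma mul_measure_exitTime_le [IsFiniteMeasure P] (hf : Martingale f ℱ P)
    (hτ : IsStoppingTime ℱ τ) (c : ℝ) (n : ℕ) :
    ENNReal.ofReal c * P {ω | exitTime f c τ ω ≤ WithTop.some n} ≤
      eLpNorm (fun ω => f n ω - stoppedProcess f (predTime τ) n ω) 1 P := by
  have hσ := isStoppingTime_exitTime hf.stronglyAdapted hτ c
  set I : Finset (ℕ × ℕ) := Finset.range (n + 1) ×ˢ Finset.range (n + 1)
  set E : ℕ × ℕ → Set Ω := fun q =>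
    {ω | τ ω = WithTop.some q.1} ∩ {ω | exitTime f c τ ω = WithTop.some q.2}
  have hEm : ∀ q, MeasurableSet (E q) := fun q =>
    (ℱ.le _ _ (hτ.measurableSet_eq q.1)).inter (ℱ.le _ _ (hσ.measurableSet_eq q.2))
  have hdisj : (I : Set (ℕ × ℕ)).PairwiseDisjoint E := by
    intro q _ r _ hqr
    refine Set.disjoint_left.2 fun ω hq hr => hqr ?_
    have h1 := hq.1.symm.trans hr.1
    have h2 := hq.2.symm.trans hr.2
    exact Prod.ext (by exact_mod_cast h1) (by exact_mod_cast h2)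
  have hcover : {ω | exitTime f c τ ω ≤ WithTop.some n} ⊆ ⋃ q ∈ I, E q := by
    intro ω hω
    obtain ⟨k, hk⟩ := WithTop.ne_top_iff_exists.1
      ((show exitTime f c τ ω ≤ WithTop.some n from hω).trans_lt (WithTop.coe_lt_top n)).ne
    have hτk := (exitTime_spec hk.symm).1.1
    obtain ⟨j, hj⟩ := WithTop.ne_top_iff_exists.1 (hτk.trans_lt (WithTop.coe_lt_top k)).ne
    rw [← hj, WithTop.coe_le_coe] at hτk
    have hkn : k ≤ n := by
      have : exitTime f c τ ω ≤ WithTop.some n := hω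
      rwa [← hk, WithTop.coe_le_coe] at this
    simp only [Set.mem_iUnion, exists_prop]
    exact ⟨(j, k), by simp [I]; omega, hj.symm, hk.symm⟩
  calc ENNReal.ofReal c * P {ω | exitTime f c τ ω ≤ WithTop.some n}
      ≤ ENNReal.ofReal c * ∑ q ∈ I, P (E q) := by
        gcongr
        exact (measure_mono hcover).trans (measure_biUnion_finset_le _ _)
    _ = ∑ q ∈ I, ENNReal.ofReal c * P (E q) := Finset.mul_sum _ _ _
    _ ≤ ∑ q ∈ I, ∫⁻ ω in E q, ‖f n ω - stoppedProcess f (predTime τ) n ω‖ₑ ∂P := by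
        refine Finset.sum_le_sum fun q hq => ?_
        obtain ⟨j, k⟩ := q
        have hk : k ≤ n := by simp [I] at hq; omega
        by_cases hjk : j ≤ k
        · have h1 : ENNReal.ofReal c * P (E (j, k)) ≤
              ∫⁻ ω in E (j, k), ‖f k ω - f (j - 1) ω‖ₑ ∂P := by
            rw [← setLIntegral_const]
            refine setLIntegral_mono' (hEm _) fun ω hω => ?_
            have h2 := (exitTime_spec hω.2).1.2
            rw [stoppedValue_predTime hω.1] at h2
            rw [Real.enorm_eq_ofReal_abs]
            exact ENNReal.ofReal_le_ofReal h2.le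
          refine h1.trans ((setLIntegral_enorm_sub_le hf ((j.sub_le 1).trans hjk) hk
            ((ℱ.mono hjk _ (hτ.measurableSet_eq j)).inter (hσ.measurableSet_eq k))).trans ?_)
          refine (setLIntegral_congr_fun (hEm _) fun ω hω => ?_).le
          simp only [stoppedProcess_predTime (f := f) hω.1 (hjk.trans hk)]
        · have : E (j, k) = ∅ := by
            refine Set.eq_empty_of_forall_notMem fun ω hω => hjk ?_
            have h2 := (exitTime_spec hω.2).1.1
            rw [show τ ω = WithTop.some j from hω.1] at h2
            exact_mod_cast h2
          simp [this]
    _ = ∫⁻ ω in ⋃ q ∈ I, E q, ‖f n ω - stoppedProcess f (predTime τ) n ω‖ₑ ∂P :=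
        (lintegral_biUnion_finset hdisj (fun q _ => hEm q) _).symm
    _ ≤ ∫⁻ ω, ‖f n ω - stoppedProcess f (predTime τ) n ω‖ₑ ∂P := setLIntegral_le_lintegral _ _
    _ = _ := eLpNorm_one_eq_lintegral_enorm.symm

lemma measure_exitTime_lt_top_le [IsFiniteMeasure P] (hf : MemBMO 1 P ℱ f)
    (h0 : bmoNorm 1 P ℱ f ≠ 0) (hτ : IsStoppingTime ℱ τ) :
    P {ω | exitTime f (2 * (bmoNorm 1 P ℱ f).toReal) τ ω < ⊤} ≤ 2⁻¹ * P {ω | τ ω < ⊤} := by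
  set B := bmoNorm 1 P ℱ f with hB
  set c := 2 * B.toReal with hc
  have hcE : ENNReal.ofReal c = 2 * B := by
    rw [hc, ENNReal.ofReal_mul zero_le_two, ENNReal.ofReal_toReal hf.2.ne, ENNReal.ofReal_ofNat]
  have hU : {ω | exitTime f c τ ω < ⊤} = ⋃ n : ℕ, {ω | exitTime f c τ ω ≤ WithTop.some n} := by
    ext ω
    simp only [Set.mem_ofPred_eq, Set.mem_iUnion]
    refine ⟨fun h => ?_, fun ⟨n, h⟩ => h.trans_lt (WithTop.coe_lt_top n)⟩
    obtain ⟨k, hk⟩ := WithTop.ne_top_iff_exists.1 h.ne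
    exact ⟨k, hk.symm.le⟩
  have hmono : Monotone fun n : ℕ => {ω | exitTime f c τ ω ≤ WithTop.some n} := fun a b hab ω hω =>
    le_trans (show exitTime f c τ ω ≤ WithTop.some a from hω) (by exact_mod_cast hab)
  rw [hU, hmono.measure_iUnion]
  refine iSup_le fun n => ?_
  have h1 := (mul_measure_exitTime_le hf.1 hτ c n).trans (eLpNorm_sub_stoppedProcess_le hf.2 hτ n)
  rw [hcE, ← hB, mul_comm 2 B, mul_assoc, ENNReal.mul_le_mul_iff_right h0 hf.2.ne] at h1
  rwa [← ENNReal.mul_le_iff_le_inv two_ne_zero ENNReal.ofNat_ne_top]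

lemma isStoppingTime_exitTime_iterate (hf : StronglyAdapted ℱ f) (c : ℝ) (m : ℕ)
    (hτ : IsStoppingTime ℱ τ) : IsStoppingTime ℱ ((exitTime f c)^[m] τ) := by
  induction m generalizing τ with
  | zero => exact hτ
  | succ m ih => exact ih (isStoppingTime_exitTime hf hτ c)

lemma measure_exitTime_iterate_lt_top_le [IsFiniteMeasure P] (hf : MemBMO 1 P ℱ f)
    (h0 : bmoNorm 1 P ℱ f ≠ 0) (hτ : IsStoppingTime ℱ τ) (m : ℕ) :
    P {ω | (exitTime f (2 * (bmoNorm 1 P ℱ f).toReal))^[m] τ ω < ⊤} ≤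
      2⁻¹ ^ m * P {ω | τ ω < ⊤} := by
  induction m with
  | zero => simp
  | succ m ih =>
    rw [Function.iterate_succ_apply', pow_succ', mul_assoc]
    exact (measure_exitTime_lt_top_le hf h0
      (isStoppingTime_exitTime_iterate hf.1.stronglyAdapted _ m hτ)).trans (by gcongr)

/-- Each exit moves the reference value by at most c, because it is read one step before the exit;
after the last exit the path stays within c of it. -/
lemma eventually_abs_sub_le {c : ℝ} {ω : Ω} (hc : 0 ≤ c) (m : ℕ) (hτ : τ ω < ⊤)
    (h : (exitTime f c)^[m] τ ω = ⊤) :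
    ∀ᶠ n in atTop, |f n ω - stoppedValue f (predTime τ) ω| ≤ m * c := by
  induction m generalizing τ with
  | zero => exact absurd h hτ.ne
  | succ m ih =>
    push_cast
    obtain ⟨j, hj⟩ := WithTop.ne_top_iff_exists.1 hτ.ne
    rcases eq_or_ne (exitTime f c τ ω) ⊤ with htop | hne
    · filter_upwards [eventually_ge_atTop j] with n hn
      have := abs_sub_le_of_exitTime_eq_top htop (n := n) (by rw [← hj]; exact_mod_cast hn)
      nlinarith [mul_nonneg (Nat.cast_nonneg (α := ℝ) m) hc]
    · obtain ⟨k, hk⟩ := WithTop.ne_top_iff_exists.1 hne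
      have hjk := (exitTime_spec hk.symm).1.1
      rw [← hj, WithTop.coe_le_coe] at hjk
      have h1 : |stoppedValue f (predTime (exitTime f c τ)) ω -
          stoppedValue f (predTime τ) ω| ≤ c := by
        rw [stoppedValue_predTime hk.symm]
        -- An exit at time j itself leaves the reference value f (j - 1) unchanged; otherwise k - 1
        -- ≥ j precedes the exit.
        rcases hjk.eq_or_lt with rfl | hlt
        · rw [stoppedValue_predTime hj.symm]; simpa using hc
        · exact (exitTime_spec hk.symm).2 (k - 1) (by omega)
            (by rw [← hj]; exact_mod_cast (by omega : j ≤ k - 1))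
      filter_upwards [ih (lt_top_iff_ne_top.2 hne) h] with n hn
      have := abs_sub_le (f n ω) (stoppedValue f (predTime (exitTime f c τ)) ω)
        (stoppedValue f (predTime τ) ω)
      linarith

/-- The stopping time τ = 0, with f_{-1} = f_0. This gives the L¹ bound needed for almost sure
convergence. -/
lemma eLpNorm_sub_zero_le [IsProbabilityMeasure P] (hf : bmoNorm 1 P ℱ f < ⊤) (n : ℕ) :
    eLpNorm (f n - f 0) 1 P ≤ bmoNorm 1 P ℱ f := by
  have h := eLpNorm_sub_stoppedProcess_le hf (isStoppingTime_const ℱ 0) n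
  have h1 : {ω : Ω | WithTop.some 0 < ⊤} = Set.univ := by
    ext; simp
  rw [h1, measure_univ, mul_one] at h
  convert h using 2
  ext ω
  exact congrArg (f n ω - ·)
    (stoppedProcess_predTime (τ := fun _ => WithTop.some 0) (j := 0) rfl (Nat.zero_le n)).symm

lemma ae_tendsto_of_memBMO [IsProbabilityMeasure P] (hf : MemBMO 1 P ℱ f) :
    ∀ᵐ ω ∂P, Tendsto (fun n => f n ω) atTop (𝓝 (Filtration.limitProcess f ℱ P ω)) := by
  have h0 : eLpNorm (f 0) 1 P ≠ ⊤ := (memLp_one_iff_integrable.2 (hf.1.integrable 0)).eLpNorm_ne_top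
  refine Submartingale.ae_tendsto_limitProcess hf.1.submartingale
    (R := (bmoNorm 1 P ℱ f + eLpNorm (f 0) 1 P).toNNReal) fun n => ?_
  rw [ENNReal.coe_toNNReal (ENNReal.add_ne_top.2 ⟨hf.2.ne, h0⟩)]
  have h1 : f n = (f n - f 0) + f 0 := by simp
  have hm : ∀ k, AEStronglyMeasurable (f k) P := fun k => (hf.1.integrable k).aestronglyMeasurable
  rw [h1]
  refine (eLpNorm_add_le ((hm n).sub (hm 0)) (hm 0) le_rfl).trans ?_
  gcongr
  exact eLpNorm_sub_zero_le hf.2 n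

lemma ae_eq_of_bmoNorm_eq_zero [IsProbabilityMeasure P] (hf : MemBMO 1 P ℱ f)
    (h0 : bmoNorm 1 P ℱ f = 0) (n : ℕ) : f n =ᵐ[P] f 0 := by
  have h := eLpNorm_sub_zero_le hf.2 n
  rw [h0, nonpos_iff_eq_zero, eLpNorm_eq_zero_iff ((hf.1.integrable n).sub
    (hf.1.integrable 0)).aestronglyMeasurable one_ne_zero] at h
  exact (sub_ae_eq_zero _ _).1 h

lemma measure_levelSet_eq_zero [IsProbabilityMeasure P] (hf : MemBMO 1 P ℱ f)
    (h0 : bmoNorm 1 P ℱ f = 0) {t : ℝ} (ht : 0 < t) : P (levelSet P ℱ f τ t) = 0 := by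
  have hae : ∀ᵐ ω ∂P, ω ∉ levelSet P ℱ f τ t := by
    filter_upwards [ae_tendsto_of_memBMO hf,
      ae_all_iff.2 (ae_eq_of_bmoNorm_eq_zero hf h0)] with ω hlim heq
    rintro ⟨hτ, hle⟩
    obtain ⟨j, hj⟩ := WithTop.ne_top_iff_exists.1 (show τ ω < ⊤ from hτ).ne
    have h1 : Filtration.limitProcess f ℱ P ω = f 0 ω :=
      tendsto_nhds_unique hlim (by simp only [heq]; exact tendsto_const_nhds)
    have h2 : t ≤ Filtration.limitProcess f ℱ P ω - stoppedValue f (predTime τ) ω := hle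
    rw [h1, stoppedValue_predTime hj.symm, heq (j - 1), sub_self] at h2
    exact ht.not_ge h2
  simpa using ae_iff.1 hae

/-- The weak John-Nirenberg inequality, along multiples of twice the `BMO` norm. -/
lemma measure_levelSet_le [IsProbabilityMeasure P] (hf : MemBMO 1 P ℱ f)
    (h0 : bmoNorm 1 P ℱ f ≠ 0) (hτ : IsStoppingTime ℱ τ) {t : ℝ} {m : ℕ}
    (hm : m * (2 * (bmoNorm 1 P ℱ f).toReal) < t) :
    P (levelSet P ℱ f τ t) ≤ 2⁻¹ ^ m * P {ω | τ ω < ⊤} := by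
  refine le_trans (measure_mono_ae ?_) (measure_exitTime_iterate_lt_top_le hf h0 hτ m)
  filter_upwards [ae_tendsto_of_memBMO hf] with ω hlim hω
  obtain ⟨hτω, hle⟩ := hω
  refine lt_top_iff_ne_top.2 fun htop => ?_
  have h1 := eventually_abs_sub_le (by positivity) m hτω htop
  have h2 := le_of_tendsto (hlim.sub_const (stoppedValue f (predTime τ) ω))
    (h1.mono fun n hn => (le_abs_self _).trans hn)
  exact absurd (hm.trans_le hle) h2.not_gt

end Martingale

/-! ### Variable exponent norms of characteristic functions. -/

section Norm

variable {P : Measure Ω} {p : Ω → ℝ}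

lemma modular_chi_div (hp : ∀ ω, 0 < p ω) (A : Set Ω) {r : ℝ} (hr : 0 < r) :
    modular P p (fun x => chi A x / r) =
      ∫⁻ x, A.indicator (fun x => ENNReal.ofReal (r ^ (-p x))) x ∂P := by
  unfold modular
  congr 1 with x
  by_cases hx : x ∈ A
  · simp [chi, hx, abs_of_pos hr, Real.inv_rpow hr.le, Real.rpow_neg hr.le]
  · simp [chi, hx, Real.zero_rpow (hp x).ne']

lemma varNorm_chi_eq_zero (hp : ∀ ω, 0 < p ω) {A : Set Ω} (hA : P A = 0) :
    varNorm P p (chi A) = 0 := by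
  refine le_antisymm (ENNReal.le_of_forall_pos_le_add fun ε hε _ => ?_) zero_le
  rw [zero_add]
  refine (iInf₂_le (ε : ℝ) ⟨NNReal.coe_pos.2 hε, ?_⟩).trans (by simp)
  rw [modular_chi_div hp A (NNReal.coe_pos.2 hε),
    lintegral_congr_ae (g := fun _ => 0), lintegral_zero]
  · exact zero_le
  · filter_upwards [measure_eq_zero_iff_ae_notMem.1 hA] with x hx
    simp [hx]

/-- Here `A` need not be measurable. -/
lemma varNorm_chi_le [IsProbabilityMeasure P] (hp : ∀ ω, 0 < p ω) {A : Set Ω} {b δ : ℝ}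
    (hb : 0 < b) (hpb : ∀ ω ∈ A, p ω ≤ b) (hδ : 0 < δ) (hδ1 : δ ≤ 1)
    (hA : P A ≤ ENNReal.ofReal δ) :
    varNorm P p (chi A) ≤ ENNReal.ofReal (δ ^ b⁻¹) := by
  have hr : 0 < δ ^ b⁻¹ := Real.rpow_pos_of_pos hδ _
  have hr1 : δ ^ b⁻¹ ≤ 1 := Real.rpow_le_one hδ.le hδ1 (by positivity)
  refine iInf₂_le (δ ^ b⁻¹) ⟨hr, ?_⟩
  rw [modular_chi_div hp A hr]
  calc ∫⁻ x, A.indicator (fun x => ENNReal.ofReal ((δ ^ b⁻¹) ^ (-p x))) x ∂P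
      ≤ ∫⁻ x, A.indicator (fun _ => ENNReal.ofReal δ⁻¹) x ∂P := by
        refine lintegral_mono fun x => Set.indicator_le_indicator' fun hx => ?_
        refine ENNReal.ofReal_le_ofReal ?_
        calc (δ ^ b⁻¹) ^ (-p x) ≤ (δ ^ b⁻¹) ^ (-b) :=
              Real.rpow_le_rpow_of_exponent_ge hr hr1 (neg_le_neg (hpb x hx))
          _ = δ⁻¹ := by
              rw [← Real.rpow_mul hδ.le, mul_neg, inv_mul_cancel₀ hb.ne', Real.rpow_neg_one]
    _ ≤ ENNReal.ofReal δ⁻¹ * P A := lintegral_indicator_const_le _ _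
    _ ≤ ENNReal.ofReal δ⁻¹ * ENNReal.ofReal δ := by gcongr
    _ = 1 := by
        rw [← ENNReal.ofReal_mul (by positivity), inv_mul_cancel₀ hδ.ne', ENNReal.ofReal_one]

lemma le_varNorm_chi [IsProbabilityMeasure P] {T : Set Ω} (hT : MeasurableSet T)
    {a : ℝ} (ha : 0 < a) (hp : ∀ ω, 0 < p ω) (hpa : ∀ ω ∈ T, a ≤ p ω) :
    ENNReal.ofReal (P.real T ^ a⁻¹) ≤ varNorm P p (chi T) := by
  refine le_iInf₂ fun r hr => ENNReal.ofReal_le_ofReal ?_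
  obtain ⟨hr0, hr⟩ := hr
  rcases le_or_gt 1 r with h1 | h1
  · exact (Real.rpow_le_one measureReal_nonneg measureReal_le_one (by positivity)).trans h1
  · rw [modular_chi_div hp T hr0] at hr
    have h2 : ENNReal.ofReal (r ^ (-a)) * P T ≤ 1 := by
      rw [← lintegral_indicator_const hT]
      refine (lintegral_mono fun x => Set.indicator_le_indicator' fun hx => ?_).trans hr
      exact ENNReal.ofReal_le_ofReal
        (Real.rpow_le_rpow_of_exponent_ge hr0 h1.le (neg_le_neg (hpa x hx)))
    rw [← ofReal_measureReal, ← ENNReal.ofReal_mul (by positivity), ENNReal.ofReal_le_one,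
      Real.rpow_neg hr0.le, inv_mul_le_iff₀ (by positivity), mul_one] at h2
    calc P.real T ^ a⁻¹ ≤ (r ^ a) ^ a⁻¹ :=
          Real.rpow_le_rpow measureReal_nonneg h2 (by positivity)
      _ = r := by rw [← Real.rpow_mul hr0.le, mul_inv_cancel₀ ha.ne', Real.rpow_one]

/-- Under the exponent condition, a set of small relative measure has small relative norm. -/
lemma varNorm_chi_le_mul [IsProbabilityMeasure P] (hp_one : ∀ ω, 1 ≤ p ω) {M K : ℝ}
    (hM : ∀ ω, p ω ≤ M) (hK1 : 1 ≤ K)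
    (hK : ∀ A : Set Ω, MeasurableSet A → P A ≠ 0 →
      (P A).toReal ^ (expInf p A - expSup p A) ≤ K)
    {A T : Set Ω} (hAT : A ⊆ T) (hT : MeasurableSet T) {ε : ℝ} (hε : 0 < ε) (hε1 : ε ≤ 1)
    (hA : P A ≤ ENNReal.ofReal ε * P T) :
    varNorm P p (chi A) ≤ ENNReal.ofReal (K * ε ^ M⁻¹) * varNorm P p (chi T) := by
  have hp : ∀ ω, 0 < p ω := fun ω => one_pos.trans_le (hp_one ω)
  rcases eq_or_ne (P T) 0 with hT0 | hT0
  · rw [hT0, mul_zero, nonpos_iff_eq_zero] at hA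
    rw [varNorm_chi_eq_zero hp hA]; exact zero_le
  have hne : (p '' T).Nonempty := (nonempty_of_measure_ne_zero hT0).image p
  have hTpos : 0 < P.real T := ENNReal.toReal_pos hT0 (measure_ne_top _ _)
  have hbelow : BddBelow (p '' T) := ⟨1, by rintro _ ⟨ω, -, rfl⟩; exact hp_one ω⟩
  have habove : BddAbove (p '' T) := ⟨M, by rintro _ ⟨ω, -, rfl⟩; exact hM ω⟩
  have hinf : ∀ ω ∈ T, expInf p T ≤ p ω := fun ω hω => csInf_le hbelow ⟨ω, hω, rfl⟩
  have hsup : ∀ ω ∈ T, p ω ≤ expSup p T := fun ω hω => le_csSup habove ⟨ω, hω, rfl⟩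
  have ha1 : 1 ≤ expInf p T := le_csInf hne (by rintro _ ⟨ω, -, rfl⟩; exact hp_one ω)
  have hbM : expSup p T ≤ M := csSup_le hne (by rintro _ ⟨ω, -, rfl⟩; exact hM ω)
  have hKT := hK T hT hT0
  rw [← measureReal_def] at hKT
  set a := expInf p T
  set b := expSup p T
  have hab : a ≤ b := by
    obtain ⟨ω, hω⟩ := nonempty_of_measure_ne_zero hT0
    exact (hinf ω hω).trans (hsup ω hω)
  have ha0 : 0 < a := one_pos.trans_le ha1
  have hb0 : 0 < b := ha0.trans_le hab
  -- The exponent condition enters here: 1/b - 1/a = (a - b)/(ab), and K^{1/(ab)} ≤ K since ab ≥ 1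
  -- and K ≥ 1.
  have hratio : P.real T ^ b⁻¹ ≤ K * P.real T ^ a⁻¹ := by
    have h1 : P.real T ^ (b⁻¹ - a⁻¹) ≤ K := by
      have h2 : b⁻¹ - a⁻¹ = (a - b) * (a * b)⁻¹ := by field_simp
      rw [h2, Real.rpow_mul hTpos.le]
      refine (Real.rpow_le_rpow (by positivity) hKT (by positivity)).trans ?_
      calc K ^ (a * b)⁻¹ ≤ K ^ (1 : ℝ) := Real.rpow_le_rpow_of_exponent_le hK1
            (inv_le_one_of_one_le₀ (one_le_mul_of_one_le_of_one_le ha1 (ha1.trans hab)))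
        _ = K := Real.rpow_one K
    rwa [Real.rpow_sub hTpos, div_le_iff₀ (by positivity)] at h1
  have hδ : P A ≤ ENNReal.ofReal (ε * P.real T) := by
    rwa [ENNReal.ofReal_mul hε.le, ofReal_measureReal]
  -- Makes the decay exponent independent of T.
  have hεb : ε ^ b⁻¹ ≤ ε ^ M⁻¹ :=
    Real.rpow_le_rpow_of_exponent_ge hε hε1 (inv_anti₀ hb0 hbM)
  calc varNorm P p (chi A) ≤ ENNReal.ofReal ((ε * P.real T) ^ b⁻¹) :=
        varNorm_chi_le hp hb0 (fun ω hω => hsup ω (hAT hω)) (by positivity)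
          (mul_le_one₀ hε1 measureReal_nonneg measureReal_le_one) hδ
    _ ≤ ENNReal.ofReal (K * ε ^ M⁻¹ * P.real T ^ a⁻¹) := by
        refine ENNReal.ofReal_le_ofReal ?_
        rw [Real.mul_rpow hε.le hTpos.le]
        calc ε ^ b⁻¹ * P.real T ^ b⁻¹ ≤ ε ^ M⁻¹ * (K * P.real T ^ a⁻¹) := by gcongr
          _ = K * ε ^ M⁻¹ * P.real T ^ a⁻¹ := by ring
    _ = ENNReal.ofReal (K * ε ^ M⁻¹) * ENNReal.ofReal (P.real T ^ a⁻¹) :=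
        ENNReal.ofReal_mul (by positivity)
    _ ≤ ENNReal.ofReal (K * ε ^ M⁻¹) * varNorm P p (chi T) := by
        gcongr
        exact le_varNorm_chi hT ha0 hp hinf

end Norm

end VarExpMartingale

theorem mainTheorem6 {Ω : Type*} {mΩ : MeasurableSpace Ω} (P : Measure Ω) [IsProbabilityMeasure P]
    (p : Ω → ℝ) (hp : Measurable p) (hp_one : ∀ ω, 1 ≤ p ω) (hp_bdd : BddAbove (Set.range p))
    (hpK : VarExpMartingale.ExponentCondition P p) :
    ∃ C₁ C₂ : ℝ, 0 < C₁ ∧ 0 < C₂ ∧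
      ∀ (ℱ : Filtration ℕ mΩ) (f : ℕ → Ω → ℝ), VarExpMartingale.MemBMO 1 P ℱ f →
        (∀ᵐ ω ∂P, Tendsto (fun n => f n ω) atTop (𝓝 (Filtration.limitProcess f ℱ P ω))) ∧
        ∀ τ : Ω → WithTop ℕ, IsStoppingTime ℱ τ → ∀ t : ℝ, 0 < t →
          (VarExpMartingale.bmoNorm 1 P ℱ f ≠ 0 →
            VarExpMartingale.varNorm P p
                (VarExpMartingale.chi (VarExpMartingale.levelSet P ℱ f τ t)) ≤
              ENNReal.ofReal
                  (C₁ * Real.exp (-(C₂ * t / (VarExpMartingale.bmoNorm 1 P ℱ f).toReal))) *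
                VarExpMartingale.varNorm P p (VarExpMartingale.chi {ω | τ ω < ⊤})) ∧
          (VarExpMartingale.bmoNorm 1 P ℱ f = 0 →
            VarExpMartingale.varNorm P p
              (VarExpMartingale.chi (VarExpMartingale.levelSet P ℱ f τ t)) = 0) := by
  obtain ⟨K, hK1, hK⟩ := hpK
  obtain ⟨M₀, hM₀⟩ := hp_bdd
  set M := max M₀ 1
  have hM : ∀ ω, p ω ≤ M := fun ω => (hM₀ ⟨ω, rfl⟩).trans (le_max_left _ _)
  have hM1 : 1 ≤ M := le_max_right _ _
  have hM0 : 0 < M := one_pos.trans_le hM1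
  have hp0 : ∀ ω, 0 < p ω := fun ω => one_pos.trans_le (hp_one ω)
  -- With m ≥ t/(2B) - 1, 2^{-m/M} ≤ 2^{1/M} exp(-(log 2) t/(2MB)), and 2^{1/M} ≤ 2.
  refine ⟨2 * K, Real.log 2 / (2 * M), by positivity, by have := Real.log_pos one_lt_two; positivity,
    fun ℱ f hf => ⟨VarExpMartingale.ae_tendsto_of_memBMO hf, fun τ hτ t ht =>
      ⟨fun h0 => ?_, fun h0 => VarExpMartingale.varNorm_chi_eq_zero hp0
        (VarExpMartingale.measure_levelSet_eq_zero hf h0 ht)⟩⟩⟩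
  set B := (VarExpMartingale.bmoNorm 1 P ℱ f).toReal
  have hB : 0 < B := ENNReal.toReal_pos h0 hf.2.ne
  -- The largest m with 2Bm < t; the strict inequality is what `measure_levelSet_le` needs.
  obtain ⟨m, hm⟩ : ∃ m : ℕ, ⌈t / (2 * B)⌉₊ = m + 1 :=
    Nat.exists_eq_succ_of_ne_zero (Nat.ceil_pos.2 (by positivity)).ne'
  have hmt : m * (2 * B) < t := by
    rw [← lt_div_iff₀ (by positivity)]
    exact Nat.lt_ceil.1 (by omega)
  have htm : t / (2 * B) ≤ m + 1 := by
    exact_mod_cast hm ▸ Nat.le_ceil (t / (2 * B))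
  have hlevel := VarExpMartingale.measure_levelSet_le hf h0 hτ hmt
  have hpow : (2⁻¹ : ℝ≥0∞) ^ m = ENNReal.ofReal ((2⁻¹ : ℝ) ^ m) := by
    rw [ENNReal.ofReal_pow (by norm_num), ENNReal.ofReal_inv_of_pos two_pos, ENNReal.ofReal_ofNat]
  rw [hpow] at hlevel
  refine (VarExpMartingale.varNorm_chi_le_mul hp_one hM hK1 hK (fun ω hω => hω.1)
    (VarExpMartingale.measurableSet_lt_top hτ)
    (by positivity) (pow_le_one₀ (by norm_num) (by norm_num)) hlevel).trans ?_
  gcongr ?_ * _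
  refine ENNReal.ofReal_le_ofReal ?_
  have hexp : ((2⁻¹ : ℝ) ^ m) ^ M⁻¹ ≤ 2 * Real.exp (-(Real.log 2 / (2 * M) * t / B)) := by
    have hlog : 0 < Real.log 2 := Real.log_pos one_lt_two
    have h1 : ((2⁻¹ : ℝ) ^ m) ^ M⁻¹ = Real.exp (-(Real.log 2 * (m / M))) := by
      rw [← Real.rpow_natCast, ← Real.rpow_mul (by norm_num), Real.rpow_def_of_pos (by norm_num),
        Real.log_inv]
      congr 1
      ring
    have h2 : (2 : ℝ) * Real.exp (-(Real.log 2 / (2 * M) * t / B)) =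
        Real.exp (Real.log 2 + -(Real.log 2 / (2 * M) * t / B)) := by
      rw [Real.exp_add, Real.exp_log two_pos]
    rw [h1, h2, Real.exp_le_exp]
    have h3 : Real.log 2 / (2 * M) * t / B = Real.log 2 * (t / (2 * B) / M) := by
      field_simp
    have h4 : t / (2 * B) / M ≤ m / M + 1 := by
      rw [div_add_one hM0.ne', div_le_div_iff_of_pos_right hM0]
      linarith
    rw [h3]
    nlinarith [mul_le_mul_of_nonneg_left h4 hlog.le]
  calc K * ((2⁻¹ : ℝ) ^ m) ^ M⁻¹ ≤ K * (2 * Real.exp (-(Real.log 2 / (2 * M) * t / B))) := by gcongr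
    _ = 2 * K * Real.exp (-(Real.log 2 / (2 * M) * t / B)) := by ring
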